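/- Let $\mathcal F_0$ be the polynomial ring over $\mathbb Z[t]$ in commuting variables $u_\lambda$, one for each partition $\lambda$. For a finite field $k$ with $q=|k|$ and a partition $\lambda$, let $N(\lambda)=\bigoplus_i k[x]/(x^{\lambda_i})$. Let $\mathcal H(q)$ be the classical Hall algebra: the $\mathbb C$-vector space with basis $(u_\lambda)_\lambda$ indexed by all partitions, with the (associative, commutative, unital) multiplication $u_\mu u_\nu=\sum_\lambda F^\lambda_{\mu,\nu}(q)\,u_\lambda$, where $F^\lambda_{\mu,\nu}(q)$ is the number of $k[x]$-submodules $U\subseteq N(\lambda)$ with $U\cong N(\mu)$ and $N(\lambda)/U\cong N(\nu)$. For $R\in\mathcal F_0$ let $R(q)\in\mathcal H(q)$ be obtained by evaluating the coefficients of $R$ at $t=q$ and interpreting the variables $u_\lambda$ as the basis elements $u_\lambda\in\mathcal H(q)$. Write $(1^l)$ for the partition $(1,\ldots,1)$ with $l$ ones. **Proposition.** For every integer $n\ge 0$ there exist a polynomial $h_n\in\mathbb Z[t]$ with leading coefficient $\pm1$ and an element $R_n\in\mathcal F_0$ which is a $\mathbb Z[t]$-linear combination of products $u_{(1^{l_1})}\cdots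 u_{(1^{l_r})}$ with $r>1$, $l_i\ge 1$ and $l_1+\cdots+l_r=n$ (consequently $l_i<n$ for all $i$), such that for every finite field $k$, with $q=|k|$, $$\sum_{\mu\vdash n}u_\mu = h_n(q)\,u_{(1^n)}+R_n(q)\qquad\text{in }\mathcal H(q).$$ -/

import Mathlib

open Polynomial

namespace ClassicalHall

/-- The type of all partitions (of all natural numbers). -/
abbrev Ptn : Type := Σ n : ℕ, n.Partition

/-- The nilpotent `k[X]`-module `N(la) = ⨁ᵢ k[X] / (X ^ laᵢ)`, the sum running over the parts of
`la` counted with multiplicity. -/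
abbrev NMod (k : Type*) [Field k] (la : Ptn) : Type _ :=
  (i : la.2.parts) → k[X] ⧸ Ideal.span {(X : k[X]) ^ (i : ℕ)}

/-- The number of submodules `U` of `Y` with `U ≃ A` and `Y / U ≃ B`. -/
noncomputable def subCount (R : Type*) [CommRing R] (Y A B : Type*)
    [AddCommGroup Y] [Module R Y] [AddCommGroup A] [Module R A] [AddCommGroup B] [Module R B] : ℕ :=
  Nat.card {U : Submodule R Y // Nonempty (U ≃ₗ[R] A) ∧ Nonempty ((Y ⧸ U) ≃ₗ[R] B)}

theorem ptn_ext {la mu : Ptn} (h : la.2.parts = mu.2.parts) : la = mu := by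
  obtain ⟨n, p, hp, hn⟩ := la
  obtain ⟨m, p', hp', hm⟩ := mu
  dsimp only at h
  subst h hn hm
  rfl

section Classification

variable {k : Type*} [Field k]

theorem card_quot_X_pow [Finite k] (a : ℕ) :
    Nat.card (k[X] ⧸ Ideal.span {(X : k[X]) ^ a}) = Nat.card k ^ a := by
  have : Module.Finite k (k[X] ⧸ Ideal.span {(X : k[X]) ^ a}) :=
    (monic_X_pow a).finite_quotient
  rw [Module.natCard_eq_pow_finrank (K := k), finrank_quotient_span_eq_natDegree, natDegree_X_pow]

instance finite_quot_X_pow [Finite k] (a : ℕ) :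
    Finite (k[X] ⧸ Ideal.span {(X : k[X]) ^ a}) := by
  apply Nat.finite_of_card_ne_zero
  rw [card_quot_X_pow]
  exact pow_ne_zero _ Nat.card_pos.ne'

/-- The cardinality of `X ^ j M`. -/
noncomputable def rangeCard (k : Type*) [Field k] (M : Type*) [AddCommGroup M] [Module k[X] M]
    (j : ℕ) : ℕ :=
  Nat.card {x : M // ∃ y : M, (X : k[X]) ^ j • y = x}

theorem rangeCard_congr {M M' : Type*} [AddCommGroup M] [Module k[X] M] [AddCommGroup M']
    [Module k[X] M'] (e : M ≃ₗ[k[X]] M') (j : ℕ) : rangeCard k M j = rangeCard k M' j := by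
  refine Nat.card_congr (e.toEquiv.subtypeEquiv fun x => ?_)
  constructor
  · rintro ⟨y, rfl⟩
    exact ⟨e y, by simp⟩
  · rintro ⟨y, hy⟩
    exact ⟨e.symm y, e.injective (by simpa using hy)⟩

theorem rangeCard_quot [Finite k] (a j : ℕ) :
    rangeCard k (k[X] ⧸ Ideal.span {(X : k[X]) ^ a}) j = Nat.card k ^ (a - j) := by
  let f : k[X] →ₗ[k[X]] (k[X] ⧸ Ideal.span {(X : k[X]) ^ a}) :=
    (LinearMap.lsmul k[X] _ (X ^ j)) ∘ₗ (Ideal.span {(X : k[X]) ^ a}).mkQ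
  have hker : LinearMap.ker f = Ideal.span {(X : k[X]) ^ (a - j)} := by
    ext g
    have h1 : f g = (Ideal.span {(X : k[X]) ^ a}).mkQ (X ^ j * g) := rfl
    rw [LinearMap.mem_ker, h1, Submodule.mkQ_apply, Submodule.Quotient.mk_eq_zero,
      Ideal.mem_span_singleton, Ideal.mem_span_singleton]
    rcases le_total a j with h | h
    · rw [Nat.sub_eq_zero_of_le h, pow_zero]
      exact ⟨fun _ => one_dvd _, fun _ => (pow_dvd_pow _ h).mul_right _⟩
    · obtain ⟨c, rfl⟩ := Nat.exists_eq_add_of_le h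
      rw [Nat.add_sub_cancel_left, pow_add]
      exact mul_dvd_mul_iff_left (pow_ne_zero _ X_ne_zero)
  rw [← card_quot_X_pow, ← hker]
  refine (Nat.card_congr (f.quotKerEquivRange.toEquiv.trans
    (Equiv.subtypeEquivRight fun x => ?_))).symm
  rw [LinearMap.mem_range]
  constructor
  · rintro ⟨y, rfl⟩
    exact ⟨(Ideal.span {(X : k[X]) ^ a}).mkQ y, rfl⟩
  · rintro ⟨y, rfl⟩
    obtain ⟨z, rfl⟩ := Submodule.mkQ_surjective _ y
    exact ⟨z, rfl⟩

theorem rangeCard_NMod [Finite k] (la : Ptn) (j : ℕ) :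
    rangeCard k (NMod k la) j = Nat.card k ^ ((la.2.parts.map fun a => a - j).sum) := by
  have h1 : rangeCard k (NMod k la) j =
      ∏ i : la.2.parts, rangeCard k (k[X] ⧸ Ideal.span {(X : k[X]) ^ (i : ℕ)}) j := by
    unfold rangeCard
    rw [← Nat.card_pi]
    refine Nat.card_congr ((Equiv.subtypeEquivRight fun x => ?_).trans
      (Equiv.subtypePiEquivPi (p := fun {i : la.2.parts}
        (x : k[X] ⧸ Ideal.span {(X : k[X]) ^ (i : ℕ)}) => ∃ y, (X : k[X]) ^ j • y = x)))
    constructor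
    · rintro ⟨y, rfl⟩ i
      exact ⟨y i, rfl⟩
    · intro h
      choose y hy using h
      exact ⟨y, funext hy⟩
  rw [h1]
  simp_rw [rangeCard_quot]
  rw [Finset.prod_pow_eq_pow_sum]
  congr 1
  conv_rhs => rw [← Multiset.map_univ_coe la.2.parts, Multiset.map_map]
  rfl

theorem multiset_eq_of_sums {s t : Multiset ℕ} (hs : ∀ i ∈ s, 0 < i) (ht : ∀ i ∈ t, 0 < i)
    (h : ∀ j, (s.map fun a => a - j).sum = (t.map fun a => a - j).sum) : s = t := by
  have key : ∀ (u : Multiset ℕ) (i : ℕ), (u.map fun a => a - i).sum +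
      (u.map fun a => a - (i + 2)).sum = 2 * (u.map fun a => a - (i + 1)).sum + u.count (i + 1) := by
    intro u i
    induction u using Multiset.induction_on with
    | empty => simp
    | cons a u ih =>
      simp only [Multiset.map_cons, Multiset.sum_cons, Multiset.count_cons]
      split_ifs with hh <;> omega
  ext i
  rcases i with _ | i
  · rw [Multiset.count_eq_zero_of_notMem fun h0 => lt_irrefl _ (hs 0 h0),
      Multiset.count_eq_zero_of_notMem fun h0 => lt_irrefl _ (ht 0 h0)]
  · have h1 := key s i
    have h2 := key t i
    rw [h, h, h] at h1
    omega

theorem ptn_eq_of_rangeCard [Finite k] {la mu : Ptn}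
    (h : ∀ j, rangeCard k (NMod k la) j = rangeCard k (NMod k mu) j) : la = mu := by
  refine ptn_ext (multiset_eq_of_sums (fun i hi => la.2.parts_pos hi)
    (fun i hi => mu.2.parts_pos hi) fun j => ?_)
  have := h j
  rw [rangeCard_NMod, rangeCard_NMod] at this
  exact Nat.pow_right_injective (Finite.one_lt_card) this

theorem card_NMod [Finite k] (la : Ptn) :
    Nat.card (NMod k la) = Nat.card k ^ (la.2.parts.sum) := by
  have h := rangeCard_NMod (k := k) la 0
  simp only [Nat.sub_zero, Multiset.map_id'] at h
  rw [← h]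
  exact Nat.card_congr (Equiv.subtypeUnivEquiv fun x => ⟨x, by simp⟩).symm

theorem exists_mapEquiv {α β : Type*} [DecidableEq α] [DecidableEq β] (s : Multiset α)
    (f : α → β) : ∃ σ : (s.map f) ≃ s, ∀ p, f (σ p : s) = (p : β) :=
  ⟨(s.mapEquiv f).symm, fun p => by
    have h := Multiset.mapEquiv_apply s f ((s.mapEquiv f).symm p)
    rw [Equiv.apply_symm_apply] at h
    exact h.symm⟩

theorem exists_ptn [Finite k] (M : Type*) [AddCommGroup M] [Module k[X] M] [Finite M]
    (hM : ∀ x : M, ∃ n : ℕ, (X : k[X]) ^ n • x = 0) :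
    ∃ la : Ptn, Nonempty (M ≃ₗ[k[X]] NMod k la) := by
  obtain ⟨d, e, ⟨E⟩⟩ := Module.torsion_by_prime_power_decomposition (R := k[X]) (M := M)
    (p := X) irreducible_X ((Submodule.isTorsion'_powers_iff (M := M) X).2 hM)
  let s : Finset (Fin d) := Finset.univ.filter fun i => e i ≠ 0
  let la : Ptn := ⟨(s.val.map e).sum, ⟨s.val.map e, by
    intro i hi
    simp only [Multiset.mem_map, Finset.mem_val, s, Finset.mem_filter] at hi
    obtain ⟨a, ha, rfl⟩ := hi
    exact Nat.pos_of_ne_zero ha.2, rfl⟩⟩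
  obtain ⟨σ, hσ⟩ : ∃ σ : la.2.parts ≃ s.val, ∀ p, e (σ p : s.val) = (p : ℕ) :=
    exists_mapEquiv s.val e
  let F : (∀ i : Fin d, k[X] ⧸ Ideal.span {(X : k[X]) ^ e i}) →ₗ[k[X]] NMod k la :=
    LinearMap.pi fun p => (Submodule.quotEquivOfEq _ _ (by rw [hσ p])).toLinearMap ∘ₗ
      LinearMap.proj ((σ p : s.val) : Fin d)
  have hF : Function.Bijective F := by
    rw [Nat.bijective_iff_injective_and_card]
    constructor
    · rw [injective_iff_map_eq_zero]
      intro x hx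
      funext i
      by_cases hi : e i = 0
      · have hs : Subsingleton (k[X] ⧸ Ideal.span {(X : k[X]) ^ e i}) := by
          rw [hi]
          exact (Nat.card_eq_one_iff_unique.1 (by rw [card_quot_X_pow, pow_zero])).1
        exact Subsingleton.elim _ _
      · have his : i ∈ s.val := by simp [s, hi]
        obtain ⟨t, ht⟩ : ∃ t : s.val, (t : Fin d) = i :=
          ⟨⟨i, ⟨0, Multiset.count_pos.2 his⟩⟩, rfl⟩
        have h := congrFun hx (σ.symm t)
        have h2 : x ((σ (σ.symm t) : s.val) : Fin d) = 0 :=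
          (Submodule.quotEquivOfEq (Ideal.span {(X : k[X]) ^ e ((σ (σ.symm t) : s.val) : Fin d)})
            (Ideal.span {(X : k[X]) ^ ((σ.symm t : la.2.parts) : ℕ)})
            (by rw [hσ])).map_eq_zero_iff.1 h
        rw [Equiv.apply_symm_apply, ht] at h2
        exact h2
    · rw [card_NMod, Nat.card_pi]
      simp_rw [card_quot_X_pow]
      rw [Finset.prod_pow_eq_pow_sum]
      congr 1
      exact (Finset.sum_filter_ne_zero _).symm
  exact ⟨la, ⟨E.trans ((DirectSum.linearEquivFunOnFintype k[X] _ _).trans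
    (LinearEquiv.ofBijective F hF))⟩⟩

theorem NMod_nilpotent (la : Ptn) (x : NMod k la) : (X : k[X]) ^ la.2.parts.sum • x = 0 := by
  funext i
  obtain ⟨y, hy⟩ := Submodule.mkQ_surjective _ (x i)
  have hi : (i : ℕ) ≤ la.2.parts.sum := Multiset.le_sum_of_mem (Multiset.coe_mem)
  rw [Pi.smul_apply, ← hy, ← map_smul, Pi.zero_apply, Submodule.mkQ_apply,
    Submodule.Quotient.mk_eq_zero, Ideal.mem_span_singleton, smul_eq_mul]
  exact (pow_dvd_pow _ hi).mul_right _

theorem exists_ptn_sub [Finite k] {la : Ptn} (U : Submodule k[X] (NMod k la)) :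
    ∃ mu : Ptn, Nonempty (U ≃ₗ[k[X]] NMod k mu) :=
  exists_ptn (k := k) U fun x => ⟨la.2.parts.sum, Subtype.ext (NMod_nilpotent la x.1)⟩

theorem exists_ptn_quot [Finite k] {la : Ptn} (U : Submodule k[X] (NMod k la)) :
    ∃ mu : Ptn, Nonempty ((NMod k la ⧸ U) ≃ₗ[k[X]] NMod k mu) :=
  have : Finite (NMod k la ⧸ U) := Finite.of_surjective _ (Submodule.mkQ_surjective U)
  exists_ptn _ fun x => ⟨la.2.parts.sum, by
    obtain ⟨y, rfl⟩ := Submodule.mkQ_surjective _ x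
    rw [← map_smul, NMod_nilpotent, map_zero]⟩

theorem ptn_eq_of_equiv [Finite k] {la mu : Ptn} (e : NMod k la ≃ₗ[k[X]] NMod k mu) : la = mu :=
  ptn_eq_of_rangeCard fun j => rangeCard_congr e j

end Classification

section Duality

variable {k : Type*} [Field k]

/-- The `k`-linear functional on `k[X] / (X ^ a)` reading off the coefficient of `X ^ (a - 1)`
(and zero if `a = 0`). -/
noncomputable def topCoeff (k : Type*) [Field k] (a : ℕ) :
    (k[X] ⧸ Ideal.span {(X : k[X]) ^ a}) →ₗ[k] k :=
  ((Ideal.span {(X : k[X]) ^ a}).restrictScalars k).liftQ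
    (if a = 0 then 0 else Polynomial.lcoeff k (a - 1)) (by
      intro f hf
      rw [Submodule.restrictScalars_mem, Ideal.mem_span_singleton] at hf
      split_ifs with h
      · simp
      · rw [LinearMap.mem_ker, Polynomial.lcoeff_apply]
        exact Polynomial.X_pow_dvd_iff.1 hf _ (by omega))

theorem topCoeff_mk {a : ℕ} (ha : a ≠ 0) (f : k[X]) :
    topCoeff k a (Ideal.Quotient.mk _ f) = f.coeff (a - 1) := by
  have : topCoeff k a (Ideal.Quotient.mk _ f) =
    (if a = 0 then 0 else Polynomial.lcoeff k (a - 1)) f := rfl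
  rw [this, if_neg ha, Polynomial.lcoeff_apply]

theorem topCoeff_nondeg {a : ℕ} (x : k[X] ⧸ Ideal.span {(X : k[X]) ^ a})
    (hx : ∀ y, topCoeff k a (x * y) = 0) : x = 0 := by
  obtain ⟨f, rfl⟩ := Ideal.Quotient.mk_surjective x
  rw [Ideal.Quotient.eq_zero_iff_mem, Ideal.mem_span_singleton, Polynomial.X_pow_dvd_iff]
  intro d hd
  have h := hx (Ideal.Quotient.mk _ (X ^ (a - 1 - d)))
  rw [← map_mul, topCoeff_mk (by omega), Polynomial.coeff_mul_X_pow', if_pos (by omega)] at h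
  rwa [show a - 1 - (a - 1 - d) = d by omega] at h

/-- A nondegenerate symmetric `k`-bilinear form on `N(la)` for which `X` is self-adjoint. -/
noncomputable def form (k : Type*) [Field k] (la : Ptn) : LinearMap.BilinForm k (NMod k la) :=
  LinearMap.mk₂ k (fun x y => ∑ i : la.2.parts, topCoeff k i (x i * y i))
    (fun x x' y => by simp [add_mul, Finset.sum_add_distrib])
    (fun c x y => by simp only [Pi.smul_apply, smul_mul_assoc, map_smul, Finset.smul_sum])
    (fun x y y' => by simp [mul_add, Finset.sum_add_distrib])
    (fun c x y => by simp only [Pi.smul_apply, mul_smul_comm, map_smul, Finset.smul_sum])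

theorem form_apply {la : Ptn} (x y : NMod k la) :
    form k la x y = ∑ i : la.2.parts, topCoeff k i (x i * y i) := rfl

theorem form_comm {la : Ptn} (x y : NMod k la) : form k la x y = form k la y x := by
  simp only [form_apply, mul_comm]

theorem form_smul {la : Ptn} (f : k[X]) (x y : NMod k la) :
    form k la (f • x) y = form k la x (f • y) := by
  simp only [form_apply, Pi.smul_apply, smul_mul_assoc, mul_smul_comm]

theorem form_separating {la : Ptn} (x : NMod k la) (hx : ∀ y, form k la x y = 0) : x = 0 := by
  classical
  funext i
  refine topCoeff_nondeg _ fun y => ?_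
  have h := hx (Pi.single i y)
  rw [form_apply, Finset.sum_eq_single i] at h
  · simpa using h
  · intro j _ hj
    simp [Pi.single_eq_of_ne hj]
  · simp

theorem form_nondegenerate (la : Ptn) : (form k la).Nondegenerate :=
  ⟨fun x hx => form_separating x hx,
    fun x hx => form_separating x fun y => by rw [form_comm]; exact hx y⟩

theorem form_isRefl (la : Ptn) : (form k la).IsRefl := fun x y h => by rw [form_comm]; exact h

/-- The orthogonal complement of a submodule of `N(la)`. -/
noncomputable def perp {la : Ptn} (U : Submodule k[X] (NMod k la)) : Submodule k[X] (NMod k la) where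
  carrier := {y | ∀ x ∈ U, form k la x y = 0}
  add_mem' := fun ha hb x hx => by rw [map_add, ha x hx, hb x hx, add_zero]
  zero_mem' := fun x _ => map_zero _
  smul_mem' := fun c y hy x hx => by
    rw [← form_smul]
    exact hy _ (U.smul_mem c hx)

theorem mem_perp {la : Ptn} {U : Submodule k[X] (NMod k la)} {y : NMod k la} :
    y ∈ perp U ↔ ∀ x ∈ U, form k la x y = 0 := Iff.rfl

theorem perp_restrictScalars {la : Ptn} (U : Submodule k[X] (NMod k la)) :
    (perp U).restrictScalars k = (form k la).orthogonal (U.restrictScalars k) := by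
  ext y
  rfl

/-- For `U ≤ W`, the image of `W` in the quotient by `U` is `W / U`. -/
theorem map_mkQ_equiv {R M : Type*} [CommRing R] [AddCommGroup M] [Module R M]
    (U W : Submodule R M) :
    Nonempty ((W ⧸ U.comap W.subtype) ≃ₗ[R] W.map U.mkQ) := by
  have hk : LinearMap.ker (U.mkQ ∘ₗ W.subtype) = U.comap W.subtype := by
    rw [LinearMap.ker_comp, Submodule.ker_mkQ]
  have hr : LinearMap.range (U.mkQ ∘ₗ W.subtype) = W.map U.mkQ := by
    rw [LinearMap.range_comp, Submodule.range_subtype]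
  exact ⟨(Submodule.quotEquivOfEq _ _ hk.symm).trans
    ((U.mkQ ∘ₗ W.subtype).quotKerEquivRange.trans (LinearEquiv.ofEq _ _ hr))⟩

/-- `X ^ j M` as a submodule. -/
noncomputable def powRange (k : Type*) [Field k] (M : Type*) [AddCommGroup M] [Module k[X] M]
    (j : ℕ) : Submodule k[X] M := LinearMap.range (LinearMap.lsmul k[X] M (X ^ j))

theorem card_map_mkQ {R M : Type*} [CommRing R] [AddCommGroup M] [Module R M]
    {U W : Submodule R M} (h : U ≤ W) :
    Nat.card (W.map U.mkQ) * Nat.card U = Nat.card W := by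
  obtain ⟨e⟩ := map_mkQ_equiv U W
  rw [← Nat.card_congr e.toEquiv, ← Nat.card_congr (Submodule.comapSubtypeEquivOfLe h).toEquiv,
    mul_comm]
  exact (Submodule.card_eq_card_quotient_mul_card _).symm

theorem rangeCard_eq (M : Type*) [AddCommGroup M] [Module k[X] M] (j : ℕ) :
    rangeCard k M j = Nat.card (powRange k M j) := rfl

theorem rangeCard_mul_ker (M : Type*) [AddCommGroup M] [Module k[X] M] (j : ℕ) :
    rangeCard k M j * Nat.card (LinearMap.ker (LinearMap.lsmul k[X] M (X ^ j))) = Nat.card M := by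
  rw [rangeCard_eq, powRange, ← Nat.card_congr (LinearMap.quotKerEquivRange _).toEquiv, mul_comm,
    ← Submodule.card_eq_card_quotient_mul_card]

theorem rangeCard_quotient {la : Ptn} (U : Submodule k[X] (NMod k la)) (j : ℕ) :
    rangeCard k (NMod k la ⧸ U) j * Nat.card U =
      Nat.card (U ⊔ powRange k (NMod k la) j : Submodule k[X] (NMod k la)) := by
  have h1 : powRange k (NMod k la ⧸ U) j = (U ⊔ powRange k (NMod k la) j).map U.mkQ := by
    rw [Submodule.map_sup, Submodule.mkQ_map_self, bot_sup_eq]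
    ext x
    simp only [powRange, Submodule.mem_map, LinearMap.mem_range, LinearMap.lsmul_apply]
    constructor
    · rintro ⟨y, rfl⟩
      obtain ⟨z, rfl⟩ := Submodule.mkQ_surjective _ y
      exact ⟨_, ⟨z, rfl⟩, by simp⟩
    · rintro ⟨_, ⟨z, rfl⟩, rfl⟩
      exact ⟨U.mkQ z, by simp⟩
  rw [rangeCard_eq, h1]
  exact card_map_mkQ le_sup_left

variable [Finite k]

theorem perp_perp {la : Ptn} (U : Submodule k[X] (NMod k la)) : perp (perp U) = U := by
  apply Submodule.restrictScalars_injective k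
  rw [perp_restrictScalars, perp_restrictScalars,
    LinearMap.BilinForm.orthogonal_orthogonal (form_nondegenerate la) (form_isRefl la)]

theorem card_perp {la : Ptn} (U : Submodule k[X] (NMod k la)) :
    Nat.card (perp U) * Nat.card U = Nat.card (NMod k la) := by
  have h := LinearMap.BilinForm.finrank_orthogonal (form_nondegenerate (k := k) la)
    (U.restrictScalars k)
  rw [← perp_restrictScalars] at h
  have h1 : Nat.card (perp U) = Nat.card ((perp U).restrictScalars k) := rfl
  have h2 : Nat.card U = Nat.card (U.restrictScalars k) := rfl
  have h3 := Submodule.finrank_le (U.restrictScalars k)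
  rw [h1, h2, Module.natCard_eq_pow_finrank (K := k) (V := (perp U).restrictScalars k),
    Module.natCard_eq_pow_finrank (K := k) (V := U.restrictScalars k),
    Module.natCard_eq_pow_finrank (K := k) (V := NMod k la), ← pow_add, h]
  congr 1
  omega

theorem perp_equiv {la : Ptn} (U : Submodule k[X] (NMod k la)) :
    Nonempty (perp U ≃ₗ[k[X]] (NMod k la ⧸ U)) := by
  obtain ⟨mu, ⟨e⟩⟩ := exists_ptn_sub (perp U)
  obtain ⟨nu, ⟨e'⟩⟩ := exists_ptn_quot U
  have : mu = nu := by
    refine ptn_eq_of_rangeCard (k := k) fun j => ?_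
    rw [← rangeCard_congr (M := perp U) e, ← rangeCard_congr (M := NMod k la ⧸ U) e']
    have h1 := rangeCard_mul_ker (k := k) (perp U) j
    have h2 := card_perp (k := k) U
    have h3 := rangeCard_quotient U j
    have h4 := card_perp (U ⊔ powRange k (NMod k la) j)
    have h5 : Nat.card (LinearMap.ker (LinearMap.lsmul k[X] (perp U) (X ^ j))) =
        Nat.card (perp (U ⊔ powRange k (NMod k la) j)) := by
      refine Nat.card_congr ⟨fun y => ⟨y.1.1, ?_⟩, fun y => ⟨⟨y.1, ?_⟩, ?_⟩, fun y => rfl,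
        fun y => rfl⟩
      · rw [mem_perp]
        intro x hx
        obtain ⟨u, hu, _, ⟨z, rfl⟩, rfl⟩ := Submodule.mem_sup.1 hx
        have hy : (X : k[X]) ^ j • (y.1.1 : NMod k la) = 0 := congrArg Subtype.val y.2
        rw [map_add, LinearMap.add_apply, y.1.2 u hu, LinearMap.lsmul_apply, form_smul, hy,
          map_zero, add_zero]
      · exact fun x hx => y.2 x (Submodule.mem_sup_left hx)
      · rw [LinearMap.mem_ker]
        refine Subtype.ext (form_separating _ fun z => ?_)
        rw [form_comm, LinearMap.lsmul_apply]
        change form k la z ((X : k[X]) ^ j • (y.1 : NMod k la)) = 0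
        rw [← form_smul]
        exact y.2 _ (Submodule.mem_sup_right ⟨z, rfl⟩)
    rw [← h5, ← h3] at h4
    have hp : 0 < Nat.card (LinearMap.ker (LinearMap.lsmul k[X] (perp U) (X ^ j))) := Nat.card_pos
    have hU : 0 < Nat.card U := Nat.card_pos
    refine Nat.eq_of_mul_eq_mul_right (mul_pos hp hU) ?_
    rw [← mul_assoc, h1, h2, ← h4]
    ring
  subst this
  exact ⟨e.trans e'.symm⟩

end Duality

section SubCount

theorem subCount_congr {R Y Y' A B : Type*} [CommRing R]
    [AddCommGroup Y] [Module R Y] [AddCommGroup Y'] [Module R Y'] [AddCommGroup A] [Module R A]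
    [AddCommGroup B] [Module R B] (e : Y ≃ₗ[R] Y') : subCount R Y A B = subCount R Y' A B := by
  refine Nat.card_congr ((Submodule.orderIsoMapComap e).toEquiv.subtypeEquiv fun U => ?_)
  have e1 : U ≃ₗ[R] U.map (e : Y →ₗ[R] Y') := e.submoduleMap U
  have e2 : (Y ⧸ U) ≃ₗ[R] (Y' ⧸ U.map (e : Y →ₗ[R] Y')) := Submodule.Quotient.equiv U _ e rfl
  exact and_congr ⟨fun ⟨f⟩ => ⟨e1.symm.trans f⟩, fun ⟨f⟩ => ⟨e1.trans f⟩⟩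
    ⟨fun ⟨f⟩ => ⟨e2.symm.trans f⟩, fun ⟨f⟩ => ⟨e2.trans f⟩⟩

/-- Both iterated counts enumerate the chains `U ≤ W ≤ Y` with `U ≃ A`, `W / U ≃ B`,
`Y / W ≃ C`. -/
theorem subCount_assoc_equiv {R Y A B C : Type*} [CommRing R]
    [AddCommGroup Y] [Module R Y] [AddCommGroup A] [Module R A]
    [AddCommGroup B] [Module R B] [AddCommGroup C] [Module R C] :
    Nonempty ((Σ W : {W : Submodule R Y // Nonempty ((Y ⧸ W) ≃ₗ[R] C)},
        {U : Submodule R W.1 // Nonempty (U ≃ₗ[R] A) ∧ Nonempty ((W.1 ⧸ U) ≃ₗ[R] B)}) ≃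
      (Σ U : {U : Submodule R Y // Nonempty (U ≃ₗ[R] A)},
        {V : Submodule R (Y ⧸ U.1) // Nonempty (V ≃ₗ[R] B) ∧
          Nonempty (((Y ⧸ U.1) ⧸ V) ≃ₗ[R] C)})) := by
  let S := {p : Submodule R Y × Submodule R Y // p.1 ≤ p.2 ∧ Nonempty (p.1 ≃ₗ[R] A) ∧
    Nonempty ((p.2 ⧸ p.1.comap p.2.subtype) ≃ₗ[R] B) ∧ Nonempty ((Y ⧸ p.2) ≃ₗ[R] C)}
  have key1 : ∀ (W : Submodule R Y) (U : Submodule R W),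
      (U.map W.subtype).comap W.subtype = U := fun W U =>
    Submodule.comap_map_eq_of_injective W.injective_subtype U
  have key2 : ∀ (W U : Submodule R Y), U ≤ W → (U.comap W.subtype).map W.subtype = U :=
    fun W U h => by rw [Submodule.map_comap_subtype, inf_eq_right.2 h]
  have key3 : ∀ (U : Submodule R Y) (V : Submodule R (Y ⧸ U)),
      (V.comap U.mkQ).map U.mkQ = V := fun U V =>
    Submodule.map_comap_eq_of_surjective (Submodule.mkQ_surjective U) V
  have key4 : ∀ (U W : Submodule R Y), U ≤ W → (W.map U.mkQ).comap U.mkQ = W :=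
    fun U W h => by rw [Submodule.comap_map_mkQ, sup_eq_right.2 h]
  have e1 : (Σ W : {W : Submodule R Y // Nonempty ((Y ⧸ W) ≃ₗ[R] C)},
        {U : Submodule R W.1 // Nonempty (U ≃ₗ[R] A) ∧ Nonempty ((W.1 ⧸ U) ≃ₗ[R] B)}) ≃ S :=
    { toFun := fun p => ⟨(p.2.1.map p.1.1.subtype, p.1.1), by
        refine ⟨Submodule.map_subtype_le _ _, ?_, ?_, p.1.2⟩
        · exact p.2.2.1.map fun f =>
            (Submodule.equivMapOfInjective _ p.1.1.injective_subtype p.2.1).symm.trans f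
        · exact p.2.2.2.map fun f => (Submodule.quotEquivOfEq _ _ (key1 p.1.1 p.2.1)).trans f⟩
      invFun := fun p => ⟨⟨p.1.2, p.2.2.2.2⟩, ⟨p.1.1.comap p.1.2.subtype,
        p.2.2.1.map fun f => (Submodule.comapSubtypeEquivOfLe p.2.1).trans f, p.2.2.2.1⟩⟩
      left_inv := by
        rintro ⟨⟨W, hW⟩, ⟨U, hU⟩⟩
        simp [key1]
      right_inv := by
        rintro ⟨⟨U, W⟩, h⟩
        exact Subtype.ext (Prod.ext (key2 _ _ h.1) rfl) }
  have e2 : (Σ U : {U : Submodule R Y // Nonempty (U ≃ₗ[R] A)},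
        {V : Submodule R (Y ⧸ U.1) // Nonempty (V ≃ₗ[R] B) ∧
          Nonempty (((Y ⧸ U.1) ⧸ V) ≃ₗ[R] C)}) ≃ S :=
    { toFun := fun p => ⟨(p.1.1, p.2.1.comap p.1.1.mkQ), by
        have hle : p.1.1 ≤ p.2.1.comap p.1.1.mkQ := Submodule.le_comap_mkQ _ _
        refine ⟨hle, p.1.2, ?_, ?_⟩
        · obtain ⟨g⟩ := map_mkQ_equiv p.1.1 (p.2.1.comap p.1.1.mkQ)
          exact p.2.2.1.map fun f => g.trans ((LinearEquiv.ofEq _ _ (key3 _ _)).trans f)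
        · exact p.2.2.2.map fun f =>
            (Submodule.quotientQuotientEquivQuotient _ _ hle).symm.trans
              ((Submodule.quotEquivOfEq _ _ (key3 _ _)).trans f)⟩
      invFun := fun p => ⟨⟨p.1.1, p.2.2.1⟩, ⟨p.1.2.map p.1.1.mkQ, by
        obtain ⟨g⟩ := map_mkQ_equiv p.1.1 p.1.2
        exact p.2.2.2.1.map fun f => g.symm.trans f, p.2.2.2.2.map fun f =>
          (Submodule.quotientQuotientEquivQuotient _ _ p.2.1).trans f⟩⟩
      left_inv := by
        rintro ⟨⟨U, hU⟩, ⟨V, hV⟩⟩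
        simp [key3]
      right_inv := by
        rintro ⟨⟨U, W⟩, h⟩
        exact Subtype.ext (Prod.ext rfl (key4 _ _ h.1)) }
  exact ⟨e1.trans e2.symm⟩

end SubCount

section HallNumbers

/-- The Hall number `F_{mu,nu}^{la}(q)`: the number of submodules `U` of `N(la)` with
`U ≃ N(mu)` and `N(la) / U ≃ N(nu)`. -/
noncomputable def hallNumber (k : Type*) [Field k] (la mu nu : Ptn) : ℕ :=
  subCount k[X] (NMod k la) (NMod k mu) (NMod k nu)

variable (k : Type*) [Field k] [Finite k]

theorem hallNumber_comm (la mu nu : Ptn) : hallNumber k la mu nu = hallNumber k la nu mu := by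
  have key : ∀ (a b : Ptn) (U : Submodule k[X] (NMod k la)),
      (Nonempty (U ≃ₗ[k[X]] NMod k a) ∧ Nonempty ((NMod k la ⧸ U) ≃ₗ[k[X]] NMod k b)) →
      (Nonempty (perp U ≃ₗ[k[X]] NMod k b) ∧
        Nonempty ((NMod k la ⧸ perp U) ≃ₗ[k[X]] NMod k a)) := by
    rintro a b U ⟨⟨f⟩, ⟨g⟩⟩
    obtain ⟨e⟩ := perp_equiv U
    obtain ⟨e'⟩ := perp_equiv (perp U)
    exact ⟨⟨e.trans g⟩, ⟨e'.symm.trans ((LinearEquiv.ofEq _ _ (perp_perp U)).trans f)⟩⟩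
  exact Nat.card_congr ⟨fun U => ⟨perp U.1, key _ _ _ U.2⟩, fun U => ⟨perp U.1, key _ _ _ U.2⟩,
    fun U => Subtype.ext (perp_perp _), fun U => Subtype.ext (perp_perp _)⟩

/-- A nonzero Hall number forces `|la| = |mu| + |nu|`. -/
theorem size_of_hallNumber_ne_zero {la mu nu : Ptn} (h : hallNumber k la mu nu ≠ 0) :
    la.1 = mu.1 + nu.1 := by
  obtain ⟨⟨U, ⟨f⟩, ⟨g⟩⟩⟩ := (Nat.card_ne_zero.1 h).1
  have h1 := Submodule.card_eq_card_quotient_mul_card U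
  rw [Nat.card_congr f.toEquiv, Nat.card_congr g.toEquiv, card_NMod, card_NMod, card_NMod,
    ← pow_add, la.2.parts_sum, mu.2.parts_sum, nu.2.parts_sum] at h1
  exact Nat.pow_right_injective Finite.one_lt_card h1

theorem finite_support_hallNumber (mu nu : Ptn) :
    {la : Ptn | hallNumber k la mu nu ≠ 0}.Finite := by
  refine (Set.finite_range fun p : (mu.1 + nu.1).Partition => (⟨_, p⟩ : Ptn)).subset ?_
  rintro ⟨n, p⟩ h
  obtain rfl : n = mu.1 + nu.1 := size_of_hallNumber_ne_zero k h
  exact ⟨p, rfl⟩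

theorem sum_subCount_left {Y : Type*} [AddCommGroup Y] [Module k[X] Y] [Finite Y]
    (τ : Submodule k[X] Y → Ptn) (hτ : ∀ W : Submodule k[X] Y, Nonempty (W ≃ₗ[k[X]] NMod k (τ W)))
    (a b c : Ptn) (s : Finset Ptn) (hs : ∀ t, hallNumber k t a b ≠ 0 → t ∈ s) :
    ∑ t ∈ s, hallNumber k t a b * subCount k[X] Y (NMod k t) (NMod k c) =
      Nat.card (Σ W : {W : Submodule k[X] Y // Nonempty ((Y ⧸ W) ≃ₗ[k[X]] NMod k c)},
        {U : Submodule k[X] W.1 // Nonempty (U ≃ₗ[k[X]] NMod k a) ∧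
          Nonempty ((W.1 ⧸ U) ≃ₗ[k[X]] NMod k b)}) := by
  classical
  let I := {W : Submodule k[X] Y // Nonempty ((Y ⧸ W) ≃ₗ[k[X]] NMod k c)}
  have : Fintype I := Fintype.ofFinite I
  have h1 : ∀ W : I, Nat.card {U : Submodule k[X] W.1 // Nonempty (U ≃ₗ[k[X]] NMod k a) ∧
          Nonempty ((W.1 ⧸ U) ≃ₗ[k[X]] NMod k b)} =
        ∑ t ∈ s, if τ W.1 = t then hallNumber k t a b else 0 := by
    intro W
    obtain ⟨e⟩ := hτ W.1
    have h2 : Nat.card {U : Submodule k[X] W.1 // Nonempty (U ≃ₗ[k[X]] NMod k a) ∧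
          Nonempty ((W.1 ⧸ U) ≃ₗ[k[X]] NMod k b)} = hallNumber k (τ W.1) a b :=
      subCount_congr (Y := W.1) e
    rw [h2, Finset.sum_ite_eq]
    split_ifs with h
    · rfl
    · by_contra h0
      exact h (hs _ h0)
  rw [Nat.card_sigma]
  change _ = ∑ W : I, _
  simp_rw [h1]
  rw [Finset.sum_comm]
  refine Finset.sum_congr rfl fun t _ => ?_
  rw [← Finset.sum_filter, Finset.sum_const, smul_eq_mul, mul_comm]
  congr 1
  rw [← Fintype.card_subtype, ← Nat.card_eq_fintype_card]
  refine Nat.card_congr ⟨fun U => ⟨⟨U.1, U.2.2⟩, ?_⟩, fun W => ⟨W.1.1, ?_, W.1.2⟩,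
    fun U => rfl, fun W => rfl⟩
  · obtain ⟨e⟩ := hτ U.1
    obtain ⟨f⟩ := U.2.1
    exact ptn_eq_of_equiv (e.symm.trans f)
  · obtain ⟨⟨W, hW⟩, rfl⟩ := W
    exact hτ W

theorem sum_subCount_right {Y : Type*} [AddCommGroup Y] [Module k[X] Y] [Finite Y]
    (τ : Submodule k[X] Y → Ptn)
    (hτ : ∀ U : Submodule k[X] Y, Nonempty ((Y ⧸ U) ≃ₗ[k[X]] NMod k (τ U)))
    (a b c : Ptn) (s : Finset Ptn) (hs : ∀ t, hallNumber k t b c ≠ 0 → t ∈ s) :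
    ∑ t ∈ s, hallNumber k t b c * subCount k[X] Y (NMod k a) (NMod k t) =
      Nat.card (Σ U : {U : Submodule k[X] Y // Nonempty (U ≃ₗ[k[X]] NMod k a)},
        {V : Submodule k[X] (Y ⧸ U.1) // Nonempty (V ≃ₗ[k[X]] NMod k b) ∧
          Nonempty (((Y ⧸ U.1) ⧸ V) ≃ₗ[k[X]] NMod k c)}) := by
  classical
  let I := {U : Submodule k[X] Y // Nonempty (U ≃ₗ[k[X]] NMod k a)}
  have : Fintype I := Fintype.ofFinite I
  have hfin : ∀ U : I, Finite (Y ⧸ U.1) := fun U =>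
    Finite.of_surjective _ (Submodule.mkQ_surjective U.1)
  have h1 : ∀ U : I, Nat.card {V : Submodule k[X] (Y ⧸ U.1) //
          Nonempty (V ≃ₗ[k[X]] NMod k b) ∧
          Nonempty (((Y ⧸ U.1) ⧸ V) ≃ₗ[k[X]] NMod k c)} =
        ∑ t ∈ s, if τ U.1 = t then hallNumber k t b c else 0 := by
    intro U
    obtain ⟨e⟩ := hτ U.1
    have h2 : Nat.card {V : Submodule k[X] (Y ⧸ U.1) //
          Nonempty (V ≃ₗ[k[X]] NMod k b) ∧
          Nonempty (((Y ⧸ U.1) ⧸ V) ≃ₗ[k[X]] NMod k c)} = hallNumber k (τ U.1) b c :=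
      subCount_congr (Y := Y ⧸ U.1) e
    rw [h2, Finset.sum_ite_eq]
    split_ifs with h
    · rfl
    · by_contra h0
      exact h (hs _ h0)
  rw [Nat.card_sigma]
  change _ = ∑ U : I, _
  simp_rw [h1]
  rw [Finset.sum_comm]
  refine Finset.sum_congr rfl fun t _ => ?_
  rw [← Finset.sum_filter, Finset.sum_const, smul_eq_mul, mul_comm]
  congr 1
  rw [← Fintype.card_subtype, ← Nat.card_eq_fintype_card]
  refine Nat.card_congr ⟨fun U => ⟨⟨U.1, U.2.1⟩, ?_⟩, fun U => ⟨U.1.1, U.1.2, ?_⟩,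
    fun U => rfl, fun U => rfl⟩
  · obtain ⟨e⟩ := hτ U.1
    obtain ⟨f⟩ := U.2.2
    exact ptn_eq_of_equiv (e.symm.trans f)
  · obtain ⟨⟨U, hU⟩, rfl⟩ := U
    exact hτ U

theorem subCount_assoc {Y : Type*} [AddCommGroup Y] [Module k[X] Y] [Finite Y]
    (τ : Submodule k[X] Y → Ptn) (hτ : ∀ W : Submodule k[X] Y, Nonempty (W ≃ₗ[k[X]] NMod k (τ W)))
    (τ' : Submodule k[X] Y → Ptn)
    (hτ' : ∀ U : Submodule k[X] Y, Nonempty ((Y ⧸ U) ≃ₗ[k[X]] NMod k (τ' U)))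
    (a b c : Ptn) (s s' : Finset Ptn)
    (hs : ∀ t, hallNumber k t a b ≠ 0 → t ∈ s) (hs' : ∀ t, hallNumber k t b c ≠ 0 → t ∈ s') :
    ∑ t ∈ s, hallNumber k t a b * subCount k[X] Y (NMod k t) (NMod k c) =
      ∑ t ∈ s', hallNumber k t b c * subCount k[X] Y (NMod k a) (NMod k t) := by
  obtain ⟨e⟩ := subCount_assoc_equiv (R := k[X]) (Y := Y) (A := NMod k a)
    (B := NMod k b) (C := NMod k c)
  rw [sum_subCount_left k τ hτ a b c s hs, sum_subCount_right k τ' hτ' a b c s' hs']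
  exact Nat.card_congr e

theorem hallNumber_assoc (la a b c : Ptn) (s s' : Finset Ptn)
    (hs : ∀ t, hallNumber k t a b ≠ 0 → t ∈ s) (hs' : ∀ t, hallNumber k t b c ≠ 0 → t ∈ s') :
    ∑ t ∈ s, hallNumber k t a b * hallNumber k la t c =
      ∑ t ∈ s', hallNumber k t b c * hallNumber k la a t := by
  choose τ hτ using fun W : Submodule k[X] (NMod k la) => exists_ptn_sub W
  choose τ' hτ' using fun W : Submodule k[X] (NMod k la) => exists_ptn_quot W
  exact subCount_assoc k τ hτ τ' hτ' a b c s s' hs hs'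

/-- The empty partition. -/
def emptyPtn : Ptn := ⟨0, ⟨0, by simp, rfl⟩⟩

theorem hallNumber_empty (la mu : Ptn) :
    hallNumber k la emptyPtn mu = if la = mu then 1 else 0 := by
  have hs : Subsingleton (NMod k emptyPtn) :=
    (Nat.card_eq_one_iff_unique.1 (by rw [card_NMod]; exact pow_zero _)).1
  have hbot : ∀ U : Submodule k[X] (NMod k la), Nonempty (U ≃ₗ[k[X]] NMod k emptyPtn) → U = ⊥ := by
    rintro U ⟨f⟩
    rw [Submodule.eq_bot_iff]
    intro x hx
    have : (⟨x, hx⟩ : U) = 0 := f.injective (Subsingleton.elim _ _)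
    exact congrArg Subtype.val this
  have e : (NMod k la ⧸ (⊥ : Submodule k[X] (NMod k la))) ≃ₗ[k[X]] NMod k la :=
    Submodule.quotEquivOfEqBot _ rfl
  split_ifs with h
  · subst h
    refine Nat.card_eq_one_iff_unique.2 ⟨⟨fun U V => Subtype.ext ?_⟩,
      ⟨⟨⊥, ⟨0⟩, ⟨e⟩⟩⟩⟩
    rw [hbot _ U.2.1, hbot _ V.2.1]
  · by_contra h0
    obtain ⟨⟨U, hU, ⟨g⟩⟩⟩ := (Nat.card_ne_zero.1 h0).1
    obtain rfl := hbot U hU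
    exact h (ptn_eq_of_equiv (e.symm.trans g))

end HallNumbers

section Algebra

/-- The (classical) Hall algebra: the free `ℂ`-vector space on the set of all partitions, with
the multiplication defined below. -/
def HallAlgebra (k : Type*) [Field k] : Type := Ptn →₀ ℂ

variable (k : Type*) [Field k]

noncomputable instance : AddCommGroup (HallAlgebra k) :=
  inferInstanceAs (AddCommGroup (Ptn →₀ ℂ))

noncomputable instance : Module ℂ (HallAlgebra k) :=
  inferInstanceAs (Module ℂ (Ptn →₀ ℂ))

/-- The basis element `u_la`. -/
noncomputable def u (la : Ptn) : HallAlgebra k := (Finsupp.single la 1 : Ptn →₀ ℂ)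

variable {k} in
theorem hall_induction {p : HallAlgebra k → Prop} (x : HallAlgebra k) (h0 : p 0)
    (hadd : ∀ x y, p x → p y → p (x + y)) (hu : ∀ (c : ℂ) la, p (c • u k la)) : p x := by
  induction x using Finsupp.induction_linear with
  | zero => exact h0
  | add f g hf hg => exact hadd _ _ hf hg
  | single la c =>
    have : (Finsupp.single la c : Ptn →₀ ℂ) = c • (Finsupp.single la 1 : Ptn →₀ ℂ) := by simp
    rw [this]
    exact hu c la

/-- The coefficient of `u_la`. -/
noncomputable def coeff (la : Ptn) : HallAlgebra k →ₗ[ℂ] ℂ := Finsupp.lapply (M := ℂ) la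

variable {k} in
theorem hall_ext {x y : HallAlgebra k} (h : ∀ la, coeff k la x = coeff k la y) : x = y :=
  Finsupp.ext h

theorem coeff_u (la mu : Ptn) : coeff k la (u k mu) = if la = mu then 1 else 0 := by
  have : coeff k la (u k mu) = (Finsupp.single mu 1 : Ptn →₀ ℂ) la := rfl
  rw [this, Finsupp.single_apply]
  exact if_congr eq_comm rfl rfl

variable [Finite k]

/-- The product `u_mu u_nu = ∑_la F_{mu,nu}^{la}(q) u_la` of two basis elements. -/
noncomputable def basisMul (mu nu : Ptn) : HallAlgebra k :=
  Finsupp.ofSupportFinite (fun la => (hallNumber k la mu nu : ℂ))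
    ((finite_support_hallNumber k mu nu).subset fun la h => by simpa using h)

/-- The multiplication of the Hall algebra: the bilinear extension of `basisMul`. -/
noncomputable def hallMul : HallAlgebra k →ₗ[ℂ] HallAlgebra k →ₗ[ℂ] HallAlgebra k :=
  Finsupp.linearCombination ℂ fun mu => Finsupp.linearCombination ℂ fun nu => basisMul k mu nu

theorem hallMul_u (mu nu : Ptn) : hallMul k (u k mu) (u k nu) = basisMul k mu nu := by
  unfold hallMul u
  erw [Finsupp.linearCombination_single, one_smul, Finsupp.linearCombination_single, one_smul]

theorem coeff_basisMul (mu nu la : Ptn) :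
    coeff k la (basisMul k mu nu) = (hallNumber k la mu nu : ℂ) := rfl

theorem basisMul_eq_sum (mu nu : Ptn) :
    basisMul k mu nu = ∑ t ∈ (finite_support_hallNumber k mu nu).toFinset,
      (hallNumber k t mu nu : ℂ) • u k t := by
  refine hall_ext fun la => ?_
  rw [coeff_basisMul, map_sum]
  simp only [map_smul, coeff_u, smul_eq_mul, mul_ite, mul_one, mul_zero]
  rw [Finset.sum_ite_eq]
  split_ifs with h
  · rfl
  · simpa using h

theorem hallMul_comm (x y : HallAlgebra k) : hallMul k x y = hallMul k y x := by
  induction x using hall_induction with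
  | h0 => simp
  | hadd x x' hx hx' => rw [map_add, map_add, LinearMap.add_apply, hx, hx']
  | hu c la =>
    rw [map_smul, map_smul, LinearMap.smul_apply]
    congr 1
    induction y using hall_induction with
    | h0 => simp
    | hadd x x' hx hx' => rw [map_add, map_add, LinearMap.add_apply, hx, hx']
    | hu c mu =>
      rw [map_smul, map_smul, LinearMap.smul_apply, hallMul_u, hallMul_u]
      congr 1
      refine hall_ext fun nu => ?_
      rw [coeff_basisMul, coeff_basisMul, hallNumber_comm]

theorem hallMul_assoc_u (a b c : Ptn) :
    hallMul k (hallMul k (u k a) (u k b)) (u k c) =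
      hallMul k (u k a) (hallMul k (u k b) (u k c)) := by
  refine hall_ext fun la => ?_
  rw [hallMul_u, hallMul_u, basisMul_eq_sum, basisMul_eq_sum k b c]
  simp only [map_sum, map_smul, LinearMap.sum_apply, LinearMap.smul_apply, hallMul_u,
    coeff_basisMul, smul_eq_mul]
  exact_mod_cast hallNumber_assoc k la a b c _ _ (fun t h => by simpa using h)
    (fun t h => by simpa using h)

theorem hallMul_assoc (x y z : HallAlgebra k) :
    hallMul k (hallMul k x y) z = hallMul k x (hallMul k y z) := by
  induction x using hall_induction with
  | h0 => simp
  | hadd x x' hx hx' => simp only [map_add, LinearMap.add_apply, hx, hx']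
  | hu c a =>
    simp only [map_smul, LinearMap.smul_apply]
    congr 1
    induction y using hall_induction with
    | h0 => simp
    | hadd x x' hx hx' => simp only [map_add, LinearMap.add_apply, hx, hx']
    | hu c b =>
      simp only [map_smul, LinearMap.smul_apply]
      congr 1
      induction z using hall_induction with
      | h0 => simp
      | hadd x x' hx hx' => simp only [map_add, hx, hx']
      | hu d c =>
        simp only [map_smul]
        rw [hallMul_assoc_u]

theorem one_hallMul (x : HallAlgebra k) : hallMul k (u k emptyPtn) x = x := by
  induction x using hall_induction with
  | h0 => simp
  | hadd x x' hx hx' => rw [map_add, hx, hx']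
  | hu c a =>
    rw [map_smul, hallMul_u]
    congr 1
    refine hall_ext fun la => ?_
    rw [coeff_basisMul, coeff_u, hallNumber_empty]
    split_ifs <;> simp

noncomputable instance : CommRing (HallAlgebra k) :=
  { (inferInstance : AddCommGroup (HallAlgebra k)) with
    mul := fun x y => hallMul k x y
    one := u k emptyPtn
    mul_assoc := hallMul_assoc k
    mul_comm := hallMul_comm k
    one_mul := one_hallMul k
    mul_one := fun x => (hallMul_comm k x _).trans (one_hallMul k x)
    left_distrib := fun x y z => map_add (hallMul k x) y z
    right_distrib := fun x y z => LinearMap.map_add₂ (hallMul k) x y z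
    zero_mul := fun x => LinearMap.map_zero₂ (hallMul k) x
    mul_zero := fun x => map_zero (hallMul k x) }

noncomputable instance : Algebra ℂ (HallAlgebra k) :=
  Algebra.ofModule (fun c x y => LinearMap.map_smul₂ (hallMul k) c x y)
    (fun c x y => map_smul (hallMul k x) c y)

theorem u_mul_u (mu nu : Ptn) : u k mu * u k nu = basisMul k mu nu := hallMul_u k mu nu

theorem one_eq_u : (1 : HallAlgebra k) = u k emptyPtn := rfl

/-- The partition `(1^l) = (1, …, 1)` of `l`. -/
def col (l : ℕ) : Ptn :=
  ⟨l, ⟨Multiset.replicate l 1, fun {i} hi => by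
    rw [Multiset.eq_of_mem_replicate hi]
    exact one_pos, by simp⟩⟩

/-- The free commutative `ℤ[t]`-algebra on symbols indexed by all partitions. -/
abbrev FreeHall : Type := MvPolynomial Ptn ℤ[X]

/-- For `R` in the free commutative `ℤ[t]`-algebra, the element `R(q)` of the Hall algebra of `k`,
obtained by evaluating the coefficients at `q = |k|` and sending the generator indexed by `la`
to `u_la`. -/
noncomputable def evalHall : FreeHall →+* HallAlgebra k :=
  MvPolynomial.eval₂Hom
    ((algebraMap ℂ (HallAlgebra k)).comp
      (Polynomial.eval₂RingHom (Int.castRingHom ℂ) (Nat.card k : ℂ))) (u k)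

end Algebra

end ClassicalHall

/-! Write h_m for the sum of all u_μ with μ a partition of m, and q = |k|. As for symmetric
functions, the h_m and the u_(1^r) satisfy a Newton-type relation: for n > 0, the sum over 0 ≤ r ≤ n
of (-1)^r q^(r choose 2) u_(1^r) h_(n-r) is zero (`sum_signedWeight_col_mul_sum_u`).

To see this, compare coefficients at u_λ with |λ| = n. Summing the Hall numbers over all quotient
types leaves the number of submodules U of N(λ) isomorphic to N(1^r) (`sum_hallNumber_right`). Such
U are exactly the r-dimensional subspaces of the kernel of X on N(λ) (`card_submodule_col`), and
this kernel is nonzero because X is nilpotent and N(λ) ≠ 0 (`nontrivial_xKer`). The coefficient is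
therefore the sum of the Möbius weights (-1)^r q^(r choose 2) over all subspaces of a nonzero finite
vector space, which vanishes (`sum_signedWeight_finrank`).

The r = 0 term is h_n itself, so the relation solves recursively for h_n as a polynomial in the
u_(1^r), with coefficients in ℤ[t] that do not depend on k (`completeElem`). The term r = n
contributes -(-1)^n q^(n choose 2) u_(1^n). Every other term is u_(1^r) h_(n-r) with 0 < r < n, and
expanding h_(n-r) gives products of at least two factors. -/

namespace ClassicalHall

/-! ### Möbius-type cancellation over the subspaces of a finite vector space -/

section SubspaceSums

variable {k V : Type*} [Field k] [AddCommGroup V] [Module k V]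

/-- The signed weight `(-1) ^ r * q ^ (r choose 2)`; up to the choice of `q` this is the Möbius
function of the lattice of subspaces of an `r`-dimensional space. -/
def signedWeight (q : ℤ) (r : ℕ) : ℤ := (-1) ^ r * q ^ r.choose 2

/-- Pascal's rule in the exponent. This is the cancellation of one subspace of dimension r + 1
against q ^ r hyperplanes in it. -/
theorem signedWeight_succ (q : ℤ) (r : ℕ) :
    signedWeight q (r + 1) = -(q ^ r * signedWeight q r) := by
  simp only [signedWeight, Nat.choose_succ_succ' r 1, Nat.choose_one_right, pow_add, pow_succ]
  ring

/-- These functionals form a coset of the kernel of evaluation at v, which is a hyperplane in the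
dual space. -/
theorem card_dual_eq_one [Finite k] [Finite V] {v : V} (hv : v ≠ 0) {r : ℕ}
    (hr : Module.finrank k V = r + 1) :
    Nat.card {f : V →ₗ[k] k // f v = 1} = Nat.card k ^ r := by
  obtain ⟨f₀, hf₀⟩ : ∃ f : V →ₗ[k] k, f v = 1 := by
    obtain ⟨f, hf, -⟩ := Submodule.exists_le_ker_of_notMem (K := k) (p := ⊥) (v := v) hv
    exact ⟨(f v)⁻¹ • f, by simp [hf]⟩
  let E : (V →ₗ[k] k) →ₗ[k] k := LinearMap.applyₗ v
  have hE : Function.Surjective E := fun c => ⟨c • f₀, by simp [E, hf₀]⟩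
  have h1 := LinearMap.finrank_range_add_finrank_ker E
  rw [LinearMap.range_eq_top.2 hE, finrank_top, Module.finrank_self,
    Module.finrank_linearMap, Module.finrank_self, hr] at h1
  have h2 : Nat.card (LinearMap.ker E) = Nat.card k ^ r := by
    rw [Module.natCard_eq_pow_finrank (K := k)]
    congr 1
    omega
  rw [← h2]
  refine Nat.card_congr ⟨fun f => ⟨f.1 - f₀, ?_⟩, fun f => ⟨f.1 + f₀, ?_⟩, fun f => ?_,
    fun f => ?_⟩
  · simp [E, f.2, hf₀]
  · have : f.1 v = 0 := f.2
    simp [this, hf₀]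
  · simp
  · simp

/-- A subspace `W` of dimension `r + 1` has `q ^ r` hyperplanes avoiding a given nonzero vector. -/
theorem card_hyperplanes_avoiding [Finite k] [Finite V] {v : V} (hv : v ≠ 0)
    {W : Submodule k V} (hvW : v ∈ W) {r : ℕ} (hr : Module.finrank k W = r + 1) :
    Nat.card {U : Submodule k V // v ∉ U ∧ U ⊔ Submodule.span k {v} = W} = Nat.card k ^ r := by
  let w : W := ⟨v, hvW⟩
  have hw : w ≠ 0 := fun h => hv (congrArg Subtype.val h)
  rw [← card_dual_eq_one hw hr]
  symm
  have hmem : ∀ (f : W →ₗ[k] k), f w = 1 → ∀ x : W, x - f x • w ∈ LinearMap.ker f := by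
    intro f hf x
    simp [hf]
  -- A hyperplane of W avoiding v is the kernel of a unique functional on W normalised to take the
  -- value 1 at v.
  refine Nat.card_congr (Equiv.ofBijective (fun f => ⟨(LinearMap.ker f.1).map W.subtype, ?_, ?_⟩)
    ⟨?_, ?_⟩)
  · rintro ⟨x, hx, hxv⟩
    obtain rfl : x = w := Subtype.ext hxv
    exact one_ne_zero (f.2.symm.trans hx)
  · apply le_antisymm
    · rw [sup_le_iff, Submodule.span_singleton_le_iff_mem]
      exact ⟨Submodule.map_subtype_le _ _, hvW⟩
    · intro x hx
      have h := hmem f.1 f.2 ⟨x, hx⟩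
      refine Submodule.mem_sup.2 ⟨_, ⟨_, h, rfl⟩, f.1 ⟨x, hx⟩ • v,
        Submodule.smul_mem _ _ (Submodule.mem_span_singleton_self v), ?_⟩
      simp [w]
  · rintro ⟨f, hf⟩ ⟨g, hg⟩ h
    have hk : LinearMap.ker f = LinearMap.ker g :=
      Submodule.map_injective_of_injective W.injective_subtype (congrArg Subtype.val h)
    -- The kernel determines f: the value f x is the only scalar c for which x - c • w lies in it.
    refine Subtype.ext (LinearMap.ext fun x => ?_)
    have h1 := hmem f hf x
    rw [hk, LinearMap.mem_ker, map_sub, map_smul, hg, smul_eq_mul, mul_one, sub_eq_zero] at h1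
    exact h1.symm
  · rintro ⟨U, hU, rfl⟩
    have hw' : w ∉ U.comap (U ⊔ Submodule.span k {v}).subtype := hU
    -- A functional vanishing on U but not at v, rescaled, is the preimage of U. Its kernel is no
    -- larger than U, since f (a + c • v) = c * f v for a in U.
    obtain ⟨f, hfw, hf⟩ := Submodule.exists_le_ker_of_notMem hw'
    refine ⟨⟨(f w)⁻¹ • f, by simp [hfw]⟩, Subtype.ext ?_⟩
    ext x
    simp only [Submodule.mem_map, LinearMap.mem_ker, LinearMap.smul_apply, smul_eq_mul,
      mul_eq_zero, inv_eq_zero, hfw, false_or]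
    constructor
    · rintro ⟨⟨y, hy⟩, hfy, rfl⟩
      obtain ⟨a, ha, b, hb, rfl⟩ := Submodule.mem_sup.1 hy
      obtain ⟨c, rfl⟩ := Submodule.mem_span_singleton.1 hb
      have h1 : f ⟨a, Submodule.mem_sup_left ha⟩ = 0 := hf ha
      have h2 : (⟨a + c • v, hy⟩ : (U ⊔ Submodule.span k {v} : Submodule k V)) =
        ⟨a, Submodule.mem_sup_left ha⟩ + c • w := rfl
      rw [h2, map_add, h1, map_smul, zero_add, smul_eq_mul, mul_eq_zero, or_iff_left hfw] at hfy
      simpa [hfy] using ha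
    · intro hx
      exact ⟨⟨x, Submodule.mem_sup_left hx⟩, hf hx, rfl⟩

/-- Fix v ≠ 0 and send each U avoiding v to W = U + ⟨v⟩. A subspace W containing v, of dimension r +
1, is hit by q ^ r subspaces of dimension r, and their total weight cancels that of W. -/
theorem sum_signedWeight_finrank [Finite k] [Finite V] [Nontrivial V]
    [Fintype (Submodule k V)] :
    ∑ U : Submodule k V, signedWeight (Nat.card k) (Module.finrank k U) = 0 := by
  classical
  obtain ⟨v, hv⟩ := exists_ne (0 : V)
  rw [← Finset.sum_filter_add_sum_filter_not Finset.univ (fun U : Submodule k V => v ∈ U),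
    ← Finset.sum_fiberwise_of_maps_to (s := Finset.univ.filter fun U : Submodule k V => v ∉ U)
      (t := Finset.univ.filter fun U : Submodule k V => v ∈ U)
      (g := fun U => U ⊔ Submodule.span k {v}), ← Finset.sum_add_distrib]
  · refine Finset.sum_eq_zero fun W hW => ?_
    have hvW : v ∈ W := by simpa using hW
    have : Nontrivial W := ⟨⟨v, hvW⟩, 0, fun h => hv (congrArg Subtype.val h)⟩
    obtain ⟨r, hr⟩ := Nat.exists_eq_succ_of_ne_zero (Module.finrank_pos (R := k) (M := W)).ne'
    have hU : ∀ U ∈ (Finset.univ.filter fun U : Submodule k V => v ∉ U).filter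
        fun U => U ⊔ Submodule.span k {v} = W,
        signedWeight (Nat.card k) (Module.finrank k U) = signedWeight (Nat.card k) r := by
      intro U hU
      simp only [Finset.mem_filter, Finset.mem_univ, true_and] at hU
      obtain ⟨hvU, rfl⟩ := hU
      have h := Submodule.finrank_sup_add_finrank_inf_eq U (Submodule.span k {v})
      have hd : U ⊓ Submodule.span k {v} = ⊥ := by
        rw [← disjoint_iff]
        exact (Submodule.disjoint_span_singleton' hv).2 hvU
      rw [hd, finrank_bot, finrank_span_singleton hv, hr] at h
      congr 1
      omega
    rw [Finset.sum_congr rfl hU, Finset.sum_const, hr, signedWeight_succ, Finset.filter_filter,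
      ← Fintype.card_subtype, ← Nat.card_eq_fintype_card, card_hyperplanes_avoiding hv hvW hr]
    simp
  · intro U _
    simpa using Submodule.mem_sup_right (Submodule.mem_span_singleton_self v)

end SubspaceSums

/-! ### Submodules of type (1^r) as subspaces of the kernel of X -/

section ElementarySubmodules

variable {k : Type*} [Field k]

/-- The kernel of `X`, as a `k`-subspace. -/
noncomputable def xKer (k M : Type*) [Field k] [AddCommGroup M] [Module k[X] M] [Module k M]
    [IsScalarTower k k[X] M] : Submodule k M :=
  (LinearMap.ker (LinearMap.lsmul k[X] M X)).restrictScalars k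

section

variable {M : Type*} [AddCommGroup M] [Module k[X] M] [Module k M] [IsScalarTower k k[X] M]

/-- On the kernel of X a polynomial acts through its constant term, so there every k-subspace is
already a k[X]-submodule. -/
theorem smul_eq_coeff_zero_smul {x : M} (hx : (X : k[X]) • x = 0) (p : k[X]) :
    p • x = p.coeff 0 • x := by
  conv_lhs => rw [← divX_mul_X_add p]
  rw [add_smul, mul_smul, hx, smul_zero, zero_add, ← algebraMap_eq, algebraMap_smul]

/-- The `k[X]`-submodules killed by `X` are the subspaces of `xKer k M`. -/
noncomputable def submoduleXKerEquiv :
    {U : Submodule k[X] M // ∀ x ∈ U, (X : k[X]) • x = 0} ≃ Submodule k (xKer k M) where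
  toFun U := (U.1.restrictScalars k).comap (xKer k M).subtype
  invFun W := ⟨{ W.map (xKer k M).subtype with
      smul_mem' := by
        rintro p _ ⟨x, hx, rfl⟩
        exact ⟨p.coeff 0 • x, W.smul_mem _ hx, (smul_eq_coeff_zero_smul x.2 p).symm⟩ }, by
      rintro _ ⟨x, _, rfl⟩
      exact x.2⟩
  left_inv U := by
    refine Subtype.ext (SetLike.ext fun x => ?_)
    constructor
    · rintro ⟨y, hy, rfl⟩
      exact hy
    · intro hx
      exact ⟨⟨x, U.2 x hx⟩, hx, rfl⟩
  right_inv W := by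
    ext x
    constructor
    · rintro ⟨y, hy, hyx⟩
      obtain rfl := Subtype.ext hyx
      exact hy
    · intro hx
      exact ⟨x, hx, rfl⟩

theorem card_submoduleXKerEquiv (U : {U : Submodule k[X] M // ∀ x ∈ U, (X : k[X]) • x = 0}) :
    Nat.card (submoduleXKerEquiv U) = Nat.card U.1 :=
  Nat.card_congr ⟨fun x => ⟨x.1.1, x.2⟩, fun x => ⟨⟨x.1, U.2 _ x.2⟩, x.2⟩, fun _ => rfl,
    fun _ => rfl⟩

theorem card_eq_pow_iff_finrank_submoduleXKerEquiv [Finite k] [Finite M]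
    (U : {U : Submodule k[X] M // ∀ x ∈ U, (X : k[X]) • x = 0}) (r : ℕ) :
    Nat.card U.1 = Nat.card k ^ r ↔ Module.finrank k (submoduleXKerEquiv U) = r := by
  rw [← card_submoduleXKerEquiv, Module.natCard_eq_pow_finrank (K := k)]
  exact (Nat.pow_right_injective Finite.one_lt_card).eq_iff

end

theorem X_smul_NMod_col (r : ℕ) (x : NMod k (col r)) : (X : k[X]) • x = 0 := by
  funext i
  have hi : (i : ℕ) = 1 := Multiset.eq_of_mem_replicate (Multiset.coe_mem (x := i))
  obtain ⟨y, hy⟩ := Submodule.mkQ_surjective _ (x i)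
  rw [Pi.smul_apply, ← hy, ← map_smul, Pi.zero_apply, Submodule.mkQ_apply,
    Submodule.Quotient.mk_eq_zero, Ideal.mem_span_singleton, smul_eq_mul, hi, pow_one]
  exact dvd_mul_right _ _

/-- When X acts as zero, the invariants `rangeCard` depend only on the cardinality. Through
`ptn_eq_of_rangeCard` the cardinality then fixes the isomorphism type. -/
theorem rangeCard_of_X_smul_eq_zero {M : Type*} [AddCommGroup M] [Module k[X] M]
    (h : ∀ x : M, (X : k[X]) • x = 0) (j : ℕ) :
    rangeCard k M j = if j = 0 then Nat.card M else 1 := by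
  split_ifs with hj
  · subst hj
    exact Nat.card_congr (Equiv.subtypeUnivEquiv fun x => ⟨x, by simp⟩)
  · obtain ⟨j, rfl⟩ := Nat.exists_eq_succ_of_ne_zero hj
    refine Nat.card_eq_one_iff_unique.2 ⟨⟨?_⟩, ⟨0, 0, smul_zero _⟩⟩
    rintro ⟨_, x, rfl⟩ ⟨_, y, rfl⟩
    refine Subtype.ext ?_
    simp only [pow_succ, mul_smul, h]

variable [Finite k]

theorem card_NMod_col (r : ℕ) : Nat.card (NMod k (col r)) = Nat.card k ^ r := by
  rw [card_NMod, (col r).2.parts_sum]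
  rfl

theorem nonempty_equiv_col_iff {la : Ptn} (U : Submodule k[X] (NMod k la)) (r : ℕ) :
    Nonempty (U ≃ₗ[k[X]] NMod k (col r)) ↔
      (∀ x ∈ U, (X : k[X]) • x = 0) ∧ Nat.card U = Nat.card k ^ r := by
  constructor
  · rintro ⟨e⟩
    refine ⟨fun x hx => ?_, by rw [Nat.card_congr e.toEquiv, card_NMod_col]⟩
    have h : (X : k[X]) • (⟨x, hx⟩ : U) = 0 := e.injective (by
      rw [map_smul, X_smul_NMod_col, map_zero])
    exact congrArg Subtype.val h
  · rintro ⟨h1, h2⟩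
    obtain ⟨mu, ⟨e⟩⟩ := exists_ptn_sub U
    obtain rfl : mu = col r := ptn_eq_of_rangeCard (k := k) fun j => by
      rw [← rangeCard_congr (M := U) e, rangeCard_of_X_smul_eq_zero (k := k) (M := U)
        (fun x => Subtype.ext (h1 x x.2)), rangeCard_of_X_smul_eq_zero (X_smul_NMod_col r), h2,
        card_NMod_col]
    exact ⟨e⟩

theorem card_submodule_col (la : Ptn) (r : ℕ) :
    Nat.card {U : Submodule k[X] (NMod k la) // Nonempty (U ≃ₗ[k[X]] NMod k (col r))} =
      Nat.card {W : Submodule k (xKer k (NMod k la)) // Module.finrank k W = r} := by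
  refine Nat.card_congr ((Equiv.subtypeEquivRight fun U => nonempty_equiv_col_iff U r).trans
    ((Equiv.subtypeSubtypeEquivSubtypeInter _ _).symm.trans
      (submoduleXKerEquiv.subtypeEquiv fun U => ?_)))
  exact card_eq_pow_iff_finrank_submoduleXKerEquiv U r

/-- If X were injective, so would be its powers; one of them is zero on N(la), which has more than
one element. -/
theorem nontrivial_xKer {la : Ptn} (hla : la.1 ≠ 0) : Nontrivial (xKer k (NMod k la)) := by
  by_contra h
  rw [not_nontrivial_iff_subsingleton] at h
  have hinj : ∀ x : NMod k la, (X : k[X]) • x = 0 → x = 0 := fun x hx =>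
    congrArg Subtype.val (Subsingleton.elim (⟨x, hx⟩ : xKer k (NMod k la)) 0)
  have hpow : ∀ (n : ℕ) (x : NMod k la), (X : k[X]) ^ n • x = 0 → x = 0 := by
    intro n
    induction n with
    | zero => simp
    | succ n ih => exact fun x hx => hinj x (ih _ (by rwa [← mul_smul, ← pow_succ]))
  have h1 : Nat.card (NMod k la) = 1 := Nat.card_eq_one_iff_unique.2
    ⟨⟨fun x y => (hpow _ x (NMod_nilpotent la x)).trans (hpow _ y (NMod_nilpotent la y)).symm⟩,
      ⟨0⟩⟩
  rw [card_NMod, la.2.parts_sum] at h1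
  exact (Nat.one_lt_pow hla Finite.one_lt_card).ne' h1

/-- This is `sum_signedWeight_finrank` for the kernel of X, with the subspaces grouped by dimension.
-/
theorem sum_signedWeight_card_submodule_col {n : ℕ} (hn : n ≠ 0) (la : n.Partition) :
    ∑ r ∈ Finset.range (n + 1), signedWeight (Nat.card k) r *
      (Nat.card {U : Submodule k[X] (NMod k ⟨n, la⟩) //
        Nonempty (U ≃ₗ[k[X]] NMod k (col r))} : ℤ) = 0 := by
  classical
  let V := xKer k (NMod k ⟨n, la⟩)
  have : Nontrivial V := nontrivial_xKer hn
  have : Fintype (Submodule k V) := Fintype.ofFinite _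
  -- N(la) has dimension n over k, so cutting the sum off at r = n loses no subspace.
  have hle : Module.finrank k V ≤ n := by
    refine (Submodule.finrank_le V).trans (Eq.le ?_)
    apply Nat.pow_right_injective (Finite.one_lt_card (α := k))
    change Nat.card k ^ _ = Nat.card k ^ n
    rw [← Module.natCard_eq_pow_finrank, card_NMod, la.parts_sum]
  rw [← sum_signedWeight_finrank (k := k) (V := V),
    ← Finset.sum_fiberwise_of_maps_to (t := Finset.range (n + 1))
      (g := fun W : Submodule k V => Module.finrank k W)]
  · refine Finset.sum_congr rfl fun r _ => ?_
    rw [card_submodule_col, Finset.sum_congr rfl (g := fun _ => signedWeight (Nat.card k) r),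
      Finset.sum_const, ← Fintype.card_subtype, ← Nat.card_eq_fintype_card, nsmul_eq_mul, mul_comm]
    intro W hW
    rw [(Finset.mem_filter.1 hW).2]
  · intro W _
    have := Submodule.finrank_le W
    simp only [Finset.mem_range]
    omega

/-- Each quotient by such a U has exactly one type, and comparing sizes makes that type a partition
of m. -/
theorem sum_hallNumber_right (la mu : Ptn) {m : ℕ} (h : la.1 = mu.1 + m) :
    ∑ nu : m.Partition, hallNumber k la mu ⟨m, nu⟩ =
      Nat.card {U : Submodule k[X] (NMod k la) // Nonempty (U ≃ₗ[k[X]] NMod k mu)} := by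
  simp only [hallNumber, subCount]
  rw [← Nat.card_sigma]
  refine Nat.card_congr (Equiv.ofBijective (fun p => ⟨p.2.1, p.2.2.1⟩) ⟨?_, ?_⟩)
  · rintro ⟨nu, U, hU⟩ ⟨nu', U', hU'⟩ hp
    obtain rfl : U = U' := congrArg Subtype.val hp
    obtain ⟨e⟩ := hU.2
    obtain ⟨e'⟩ := hU'.2
    have := ptn_eq_of_equiv (e.symm.trans e')
    obtain rfl : nu = nu' := by simpa using this
    rfl
  · rintro ⟨U, hU⟩
    obtain ⟨⟨m', nu⟩, hnu⟩ := exists_ptn_quot U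
    have hne : hallNumber k la mu ⟨m', nu⟩ ≠ 0 :=
      Nat.card_ne_zero.2 ⟨⟨⟨U, hU, hnu⟩⟩, inferInstance⟩
    have := size_of_hallNumber_ne_zero k hne
    obtain rfl : m' = m := by dsimp only at this; omega
    exact ⟨⟨nu, U, hU, hnu⟩, rfl⟩

end ElementarySubmodules

/-! ### The recursion for the sum of all u_mu, in the Hall algebra and in the free algebra -/

section CompleteElements

variable (k : Type*) [Field k] [Finite k]

theorem col_zero : col 0 = emptyPtn := ptn_ext rfl

/-- In the Hall algebra, `∑ᵣ (-1) ^ r q ^ (r choose 2) u_(1 ^ r) h_(n - r) = 0` for `n > 0`, where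
`h_m` is the sum of the basis elements indexed by the partitions of `m`. -/
theorem sum_signedWeight_col_mul_sum_u {n : ℕ} (hn : n ≠ 0) :
    ∑ r ∈ Finset.range (n + 1), (signedWeight (Nat.card k) r : ℂ) •
      (u k (col r) * ∑ mu : (n - r).Partition, u k ⟨n - r, mu⟩) = 0 := by
  refine hall_ext fun la => ?_
  simp only [Finset.mul_sum, map_sum, map_smul, u_mul_u, coeff_basisMul, map_zero, smul_eq_mul]
  simp only [← Finset.mul_sum]
  obtain ⟨m, la⟩ := la
  -- Only partitions of n can occur: every product in the sum is homogeneous of degree r + (n - r) =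
  -- n.
  by_cases hm : m = n
  · subst hm
    have h := sum_signedWeight_card_submodule_col (k := k) hn la
    have h2 : ∀ r ∈ Finset.range (m + 1), (signedWeight (Nat.card k) r : ℂ) *
        ∑ mu : (m - r).Partition, (hallNumber k ⟨m, la⟩ (col r) ⟨m - r, mu⟩ : ℂ) =
        ((signedWeight (Nat.card k) r * (Nat.card {U : Submodule k[X] (NMod k ⟨m, la⟩) //
          Nonempty (U ≃ₗ[k[X]] NMod k (col r))} : ℤ) : ℤ) : ℂ) := by
      intro r hr
      rw [← sum_hallNumber_right (m := m - r)]
      · push_cast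
        rfl
      · have := Finset.mem_range.1 hr
        change m = r + (m - r)
        omega
    rw [Finset.sum_congr rfl h2, ← Int.cast_sum, h, Int.cast_zero]
  · refine Finset.sum_eq_zero fun r hr => ?_
    rw [Finset.sum_eq_zero, mul_zero]
    intro mu _
    rw [Nat.cast_eq_zero]
    by_contra h0
    have h1 := size_of_hallNumber_ne_zero k h0
    have h2 := Finset.mem_range.1 hr
    change m = r + (n - r) at h1
    omega

/-- The element of the free algebra, a combination of products of the generators indexed by the
`(1 ^ r)`, that evaluates to the sum of all `u_mu` with `mu` a partition of `n`. -/
noncomputable def completeElem : ℕ → FreeHall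
  | 0 => 1
  -- The relation in degree n + 1, solved for its r = 0 term. The index is shifted by one, so n - r
  -- stands for (n + 1) - (r + 1), and t replaces q.
  | n + 1 => -∑ r : Fin (n + 1), ((-1) ^ (r.1 + 1) * X ^ (r.1 + 1).choose 2 : ℤ[X]) •
      (MvPolynomial.X (col (r.1 + 1)) * completeElem (n - r.1))

theorem completeElem_succ (n : ℕ) : completeElem (n + 1) =
    -∑ r ∈ Finset.range (n + 1), ((-1) ^ (r + 1) * X ^ (r + 1).choose 2 : ℤ[X]) •
      (MvPolynomial.X (col (r + 1)) * completeElem (n - r)) := by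
  rw [completeElem, Finset.sum_range]

theorem evalHall_smul (p : ℤ[X]) (P : FreeHall) :
    evalHall k (p • P) = (p.eval₂ (Int.castRingHom ℂ) (Nat.card k : ℂ)) • evalHall k P := by
  rw [MvPolynomial.smul_eq_C_mul, map_mul, Algebra.smul_def]
  congr 1
  simp [evalHall]

theorem evalHall_X (la : Ptn) : evalHall k (MvPolynomial.X la) = u k la := by
  simp [evalHall]

theorem sum_u_zero : ∑ mu : (0 : ℕ).Partition, u k ⟨0, mu⟩ = 1 := by
  rw [Fintype.sum_unique, one_eq_u]
  congr 1

theorem evalHall_completeElem (n : ℕ) :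
    evalHall k (completeElem n) = ∑ mu : n.Partition, u k ⟨n, mu⟩ := by
  induction n using Nat.strong_induction_on with
  | _ n ih =>
    rcases n with _ | n
    · rw [completeElem, map_one, sum_u_zero]
    · have h := sum_signedWeight_col_mul_sum_u k n.succ_ne_zero
      -- Splits off the term of index 0, which is the wanted sum itself because u_(1^0) = 1 has
      -- weight 1.
      rw [Finset.sum_range_succ', col_zero, ← one_eq_u, one_mul] at h
      simp only [Nat.succ_eq_add_one, Nat.sub_zero, signedWeight, pow_zero,
        Nat.choose_zero_succ, one_mul, Int.cast_one, one_smul] at h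
      rw [completeElem_succ, map_neg, map_sum, neg_eq_iff_add_eq_zero, ← h]
      congr 1
      refine Finset.sum_congr rfl fun r _ => ?_
      rw [evalHall_smul, map_mul, evalHall_X, show n - r = n + 1 - (r + 1) by omega,
        ih (n + 1 - (r + 1)) (by omega)]
      congr 1
      simp [eval₂_mul, eval₂_pow]

/-- Here products of any length are allowed, including the empty one for n = 0. The bound on the
length in the proposition comes from one further factor multiplied in there. -/
theorem completeElem_mem_span (n : ℕ) :
    completeElem n ∈ Submodule.span ℤ[X] {P : FreeHall | ∃ l : List ℕ,
      (∀ i ∈ l, 0 < i) ∧ l.sum = n ∧ P = (l.map fun i => MvPolynomial.X (col i)).prod} := by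
  induction n using Nat.strong_induction_on with
  | _ n ih =>
    rcases n with _ | n
    · exact Submodule.subset_span ⟨[], by simp, rfl, by simp [completeElem]⟩
    · rw [completeElem_succ]
      refine Submodule.neg_mem _ (Submodule.sum_mem _ fun r hr => Submodule.smul_mem _ _ ?_)
      have hr := Finset.mem_range.1 hr
      refine Submodule.span_induction ?_ ?_ ?_ ?_ (ih (n - r) (by omega))
      · rintro _ ⟨l, h1, h2, rfl⟩
        refine Submodule.subset_span ⟨(r + 1) :: l, ?_, ?_, by simp⟩
        · simpa using h1
        · rw [List.sum_cons, h2]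
          omega
      · simp
      · intro x y _ _ hx hy
        rw [mul_add]
        exact Submodule.add_mem _ hx hy
      · intro a x _ hx
        rw [mul_smul_comm]
        exact Submodule.smul_mem _ _ hx

end CompleteElements
end ClassicalHall

/-! ### The proposition: separating the term r = n of the recursion -/

theorem proposition4p3 (n : ℕ) :
    ∃ (h : ℤ[X]) (R : ClassicalHall.FreeHall),
      (h.leadingCoeff = 1 ∨ h.leadingCoeff = -1) ∧
      R ∈ Submodule.span ℤ[X] {P : ClassicalHall.FreeHall | ∃ l : List ℕ,
        1 < l.length ∧ (∀ i ∈ l, 0 < i ∧ i < n) ∧ l.sum = n ∧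
        P = (l.map fun i => MvPolynomial.X (ClassicalHall.col i)).prod} ∧
      ∀ (k : Type*) [Field k] [Finite k],
        ∑ μ : n.Partition, ClassicalHall.u k ⟨n, μ⟩ =
          ((h.eval (Nat.card k : ℤ) : ℤ) : ℂ) • ClassicalHall.u k (ClassicalHall.col n) +
            ClassicalHall.evalHall k R := by
  open ClassicalHall in
  rcases n with _ | n
  -- In degree 0 both the sum and u_(1^0) are the unit.
  · refine ⟨1, 0, by simp, Submodule.zero_mem _, fun k _ _ => ?_⟩
    rw [sum_u_zero, col_zero, ← one_eq_u]
    simp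
  -- The polynomial is the coefficient of the last summand, r = n, of `completeElem (n + 1)`, with
  -- sign -(-1)^(n+1). The element R collects the summands r < n.
  · refine ⟨(-1) ^ n * X ^ (n + 1).choose 2,
      -∑ r ∈ Finset.range n, ((-1) ^ (r + 1) * X ^ (r + 1).choose 2 : ℤ[X]) •
        (MvPolynomial.X (col (r + 1)) * completeElem (n - r)), ?_, ?_, fun k _ _ => ?_⟩
    · rcases neg_one_pow_eq_or ℤ[X] n with h | h <;> simp [h]
    · refine Submodule.neg_mem _ (Submodule.sum_mem _ fun r hr => Submodule.smul_mem _ _ ?_)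
      have hr := Finset.mem_range.1 hr
      refine Submodule.span_induction ?_ ?_ ?_ ?_ (completeElem_mem_span (n - r))
      · rintro _ ⟨l, h1, h2, rfl⟩
        -- Since r < n, the remaining degree n - r is positive. So l is nonempty and the extended
        -- product has at least two factors.
        have hl : 0 < l.length := by
          rw [List.length_pos_iff]
          rintro rfl
          rw [List.sum_nil] at h2
          omega
        refine Submodule.subset_span ⟨(r + 1) :: l, ?_, ?_, ?_, by simp⟩
        · simpa using hl
        · intro i hi
          rcases List.mem_cons.1 hi with rfl | hi
          · omega
          · have := List.le_sum_of_mem hi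
            exact ⟨h1 i hi, by omega⟩
        · rw [List.sum_cons, h2]
          omega
      · simp
      · intro x y _ _ hx hy
        rw [mul_add]
        exact Submodule.add_mem _ hx hy
      · intro a x _ hx
        rw [mul_smul_comm]
        exact Submodule.smul_mem _ _ hx
    -- The summand r = n involves `completeElem 0`, which is 1, so it is a multiple of u_(1^(n+1))
    -- alone.
    · rw [← evalHall_completeElem, completeElem_succ, Finset.sum_range_succ, neg_add_rev, map_add]
      congr 1
      rw [Nat.sub_self, completeElem, mul_one, ← neg_smul, evalHall_smul, evalHall_X]
      congr 1
      simp [eval₂_mul, eval₂_pow, pow_succ]
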